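/- For a real number $x$ let $\|x\|$ denote the distance from $x$ to the nearest integer, let $\mathbf{e}(x)=e^{2\pi i x}$, and let $\Lambda$ be the von Mangoldt function. The type of an irrational number $\gamma$ is $$\tau=\sup\Bigl\{\varrho\in\mathbb{R} : \liminf_{n\to\infty,\ n\in\mathbb{N}} n^{\varrho}\,\|\gamma n\|=0\Bigr\}\in[1,\infty].$$ **Theorem.** Let $\gamma$ be a fixed irrational number of finite type $\tau<\infty$. Then, for every real number $0<\varepsilon<1/(8\tau)$, there is a number $\eta>0$ (depending only on $\gamma$ and $\varepsilon$) such that the bound $$\left|\sum_{\substack{m\le M\\ m\equiv a\ (\mathrm{mod}\ q)}}\Lambda(m)\,\mathbf{e}(\gamma k m)\right|\le M^{1-\eta}$$ holds for all integers $1\le k\le M^{\varepsilon}$ and $0\le a<q\le M^{\varepsilon/4}$ with $\gcd(a,q)=1$, provided that the real number $M$ is sufficiently large (in terms of $\gamma$, $\varepsilon$ and $\eta$ only; the sum is over positive integers $m$). -/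

import Mathlib

open Filter

noncomputable section

/-- The distance from the real number `x` to the nearest integer. -/
def distNearestInt (x : ℝ) : ℝ := |x - round x|

/-- `distNearestInt x` is the minimum of `|x - n|` over all integers `n`. -/
theorem isLeast_distNearestInt (x : ℝ) :
    IsLeast (Set.range fun n : ℤ => |x - (n : ℝ)|) (distNearestInt x) :=
  ⟨⟨round x, rfl⟩, by rintro _ ⟨n, rfl⟩; exact round_le x n⟩

/-- The type of a real number `γ`: the supremum of all real `ϱ` such that
`liminf_{n → ∞} n ^ ϱ * ‖γ n‖ = 0`, where `‖ ‖` is the distance to the nearest integer.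
Both the lower limit and the supremum are taken in the extended reals, so that infinite
values are allowed. -/
def diophantineType (γ : ℝ) : EReal :=
  sSup ((fun ϱ : ℝ => (ϱ : EReal)) ''
    {ϱ : ℝ | liminf (fun n : ℕ => (((n : ℝ) ^ ϱ * distNearestInt (γ * n) : ℝ) : EReal)) atTop = 0})

/-- The additive character `e(x) = exp(2πix)`. -/
def eChar (x : ℝ) : ℂ := Complex.exp (2 * Real.pi * Complex.I * x)

/-- The sum of `Λ(m) e(γ k m)` over the positive integers `m ≤ M` with `m ≡ a (mod q)`. -/
def mangoldtExpSum (γ : ℝ) (k a q : ℕ) (M : ℝ) : ℂ :=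
  ∑ m ∈ (Finset.Icc 1 ⌊M⌋₊).filter (fun m => m ≡ a [MOD q]),
    (ArithmeticFunction.vonMangoldt m : ℂ) * eChar (γ * k * m)

end

/-!
The sum over a residue class modulo `q` is an average over `b mod q` of sums `∑ Λ(m) e(θ m)` with
`θ = γ k + b / q` (`norm_mangoldtExpSum_le`), so it is enough to save a power of `M` in each of
these. By Vinogradov's method this is possible as soon as `θ` has a rational approximation whose
denominator `s` is neither smaller than a fixed power of `M` nor larger than `M ^ (1 - σ)`, for some
fixed `σ > 0`.

Dirichlet's theorem gives an approximation with `s ≤ M ^ (1 - σ)`. If `s` were small, then `q s k`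
would be a small integer for which `γ q s k` is very close to an integer
(`le_den_rpow_of_approx`). This contradicts the finite type of `γ`: for every exponent `ϱ` above
the type, `‖γ n‖ ≥ c n ^ (-ϱ)` for all `n ≥ 1` (`exists_le_distNearestInt_of_type_lt`). The
hypothesis `ε < 1 / (8 τ)` allows `ϱ = 1 / (8 ε)`.

The information on `θ` is used only through the spacing property `‖θ j‖ ≥ 1 / (6 J)` for
`1 ≤ j ≤ J`, with `J = ⌊s / 2⌋` (`le_distNearestInt_of_approx`). Vaughan's identity
(`vonMangoldt_eq_vaughan`) with both cut-offs equal to a small power `V` of `M` splits `Λ` into a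
short sum, two linear sums and a bilinear sum. Since `V ^ 2 ≤ J`, each inner sum of a linear sum is a
geometric sum of size at most `O(J log M)`, and there are at most `V ^ 2` of them
(`norm_type_one_sum_le`). In the bilinear sum `∑ b(v) g(u) e(θ u v)`, with `|b|` bounded by the
divisor function, the Cauchy–Schwarz inequality is applied with the weights `1 / v` and `v`
(`norm_type_two_sum_le`); these weights make a dyadic decomposition unnecessary. The remaining sum
over `u, u'` of `min((N / u) ^ 2, (N / u) / ‖θ (u - u')‖)` is evaluated by the spacing of the
multiples of `θ` modulo `1` (`sum_Ico_le_of_spaced`). Altogether the saving is `√V` up to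
logarithms (`norm_sum_vonMangoldt_eChar_le`).
-/

open scoped ArithmeticFunction.zeta ArithmeticFunction.Moebius ArithmeticFunction.vonMangoldt

/-! ### The additive character and geometric sums -/

theorem norm_eChar (x : ℝ) : ‖eChar x‖ = 1 := by
  have h : (2 * Real.pi * Complex.I * x : ℂ) = ((2 * Real.pi * x : ℝ) : ℂ) * Complex.I := by
    push_cast; ring
  rw [eChar, h, Complex.norm_exp_ofReal_mul_I]

theorem eChar_add (x y : ℝ) : eChar (x + y) = eChar x * eChar y := by
  rw [eChar, eChar, eChar, ← Complex.exp_add]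
  congr 1
  push_cast
  ring

theorem eChar_zero : eChar 0 = 1 := by simp [eChar]

theorem eChar_intCast (n : ℤ) : eChar n = 1 := by
  rw [eChar, ← Complex.exp_int_mul_two_pi_mul_I n]
  congr 1
  push_cast
  ring

theorem eChar_mul_natCast (x : ℝ) (n : ℕ) : eChar (x * n) = eChar x ^ n := by
  rw [eChar, eChar, ← Complex.exp_nat_mul]
  congr 1
  push_cast
  ring

theorem conj_eChar (x : ℝ) : (starRingEnd ℂ) (eChar x) = eChar (-x) := by
  rw [eChar, eChar, ← Complex.exp_conj]
  congr 1
  simp only [map_mul, map_ofNat, Complex.conj_ofReal, Complex.conj_I, Complex.ofReal_neg]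
  ring

theorem distNearestInt_nonneg (x : ℝ) : 0 ≤ distNearestInt x := abs_nonneg _

theorem distNearestInt_le_abs_sub (x : ℝ) (n : ℤ) : distNearestInt x ≤ |x - n| := round_le x n

theorem distNearestInt_le_half (x : ℝ) : distNearestInt x ≤ 1 / 2 := abs_sub_round x

/-- This is `|e(x) - 1| = 2 |sin(π x)|` together with Jordan's inequality `sin t ≥ 2 t / π` on
`[0, π / 2]`. -/
theorem four_mul_distNearestInt_le (x : ℝ) : 4 * distNearestInt x ≤ ‖eChar x - 1‖ := by
  have hx : eChar x = eChar (x - round x) := by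
    rw [← mul_one (eChar (x - round x)), ← eChar_intCast (round x), ← eChar_add]
    congr 1
    ring
  have hy := abs_sub_round x
  rw [hx, distNearestInt]
  set y := x - round x
  have h1 : eChar y = Complex.exp (Complex.I * ((2 * Real.pi * y : ℝ) : ℂ)) := by
    rw [eChar]; congr 1; push_cast; ring
  rw [h1, Complex.norm_exp_I_mul_ofReal_sub_one, norm_mul, Real.norm_ofNat, Real.norm_eq_abs,
    show 2 * Real.pi * y / 2 = Real.pi * y by ring]
  have h2 : |Real.sin (Real.pi * y)| = Real.sin (Real.pi * |y|) := by
    have hn : 0 ≤ Real.sin (Real.pi * |y|) :=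
      Real.sin_nonneg_of_nonneg_of_le_pi (by positivity) (by nlinarith [Real.pi_pos])
    rcases abs_cases y with ⟨h, _⟩ | ⟨h, _⟩
    · rw [h] at hn ⊢; rw [abs_of_nonneg hn]
    · rw [h, mul_neg, Real.sin_neg] at hn ⊢; rw [abs_of_nonpos (by linarith)]
  have h3 := Real.mul_le_sin (x := Real.pi * |y|) (by positivity) (by nlinarith [Real.pi_pos])
  have h4 : 2 / Real.pi * (Real.pi * |y|) = 2 * |y| := by
    field_simp
  rw [h2]; linarith

/-- The bound `‖∑ e(x n)‖ ≤ 1 / (2 ‖x‖)` for a geometric sum, in a form that is also meaningful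
when `x` is an integer. -/
theorem norm_sum_eChar_mul_dist_le (x : ℝ) (N : ℕ) :
    ‖∑ n ∈ Finset.Ioc 0 N, eChar (x * n)‖ * distNearestInt x ≤ 1 / 2 := by
  have h1 : (∑ n ∈ Finset.Ioc 0 N, eChar (x * n)) * (eChar x - 1)
      = eChar x * (eChar (x * N) - 1) := by
    induction N with
    | zero => simp [eChar_zero]
    | succ N ih =>
      rw [Finset.sum_Ioc_succ_top (Nat.zero_le N), add_mul, ih]
      simp only [eChar_mul_natCast]
      ring
  have h2 : ‖∑ n ∈ Finset.Ioc 0 N, eChar (x * n)‖ * ‖eChar x - 1‖ ≤ 2 := by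
    rw [← norm_mul, h1, norm_mul, norm_eChar, one_mul]
    refine (norm_sub_le _ _).trans ?_
    rw [norm_eChar, norm_one]; norm_num
  nlinarith [four_mul_distNearestInt_le x, norm_nonneg (∑ n ∈ Finset.Ioc 0 N, eChar (x * n))]

/-- Abel summation: a nonnegative increasing weight costs at most a factor `2 w(N)`. -/
theorem norm_sum_monotone_mul_le {w : ℕ → ℝ} (hw : Monotone w) (hw0 : 0 ≤ w 0) {z : ℕ → ℂ}
    {B : ℝ} (hz : ∀ n, ‖∑ i ∈ Finset.Ioc 0 n, z i‖ ≤ B) (N : ℕ) :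
    ‖∑ n ∈ Finset.Ioc 0 N, (w n : ℂ) * z n‖ ≤ 2 * w N * B := by
  have h1 : ∑ n ∈ Finset.Ioc 0 N, (w n : ℂ) * z n = w N * ∑ i ∈ Finset.Ioc 0 N, z i
      - ∑ t ∈ Finset.range N, ((w (t + 1) - w t : ℝ) : ℂ) * ∑ i ∈ Finset.Ioc 0 t, z i := by
    induction N with
    | zero => simp
    | succ N ih =>
      rw [Finset.sum_Ioc_succ_top (Nat.zero_le N), ih, Finset.sum_range_succ,
        Finset.sum_Ioc_succ_top (Nat.zero_le N)]
      push_cast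
      ring
  have hB : 0 ≤ B := (norm_nonneg _).trans (hz 0)
  have hN : 0 ≤ w N := hw0.trans (hw (Nat.zero_le N))
  have h2 : ‖∑ t ∈ Finset.range N, ((w (t + 1) - w t : ℝ) : ℂ) * ∑ i ∈ Finset.Ioc 0 t, z i‖
      ≤ (w N - w 0) * B := by
    rw [← Finset.sum_range_sub, Finset.sum_mul]
    refine norm_sum_le_of_le _ fun t _ => ?_
    have : 0 ≤ w (t + 1) - w t := sub_nonneg.2 (hw (Nat.le_succ t))
    rw [norm_mul, Complex.norm_real, Real.norm_eq_abs, abs_of_nonneg this]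
    exact mul_le_mul_of_nonneg_left (hz t) this
  rw [h1]
  refine (norm_sub_le _ _).trans ?_
  rw [norm_mul, Complex.norm_real, Real.norm_eq_abs, abs_of_nonneg hN]
  nlinarith [mul_le_mul_of_nonneg_left (hz N) hN]

theorem norm_sum_monotone_mul_eChar_mul_dist_le {w : ℕ → ℝ} (hw : Monotone w) (hw0 : 0 ≤ w 0)
    (x : ℝ) (N : ℕ) :
    ‖∑ n ∈ Finset.Ioc 0 N, (w n : ℂ) * eChar (x * n)‖ * distNearestInt x ≤ w N := by
  have hN : 0 ≤ w N := hw0.trans (hw (Nat.zero_le N))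
  rcases (distNearestInt_nonneg x).eq_or_lt with h | h
  · rw [← h, mul_zero]; exact hN
  · have := norm_sum_monotone_mul_le hw hw0 (z := fun n => eChar (x * n))
      (B := 1 / 2 / distNearestInt x)
      (fun n => (le_div_iff₀ h).2 (norm_sum_eChar_mul_dist_le x n)) N
    refine (mul_le_mul_of_nonneg_right this h.le).trans_eq ?_
    field_simp

/-! ### Sums over spaced multiples -/

/-- If the points `θ, 2θ, …, (J - 1)θ` all have distance at least `δ` to the integers, then the
residues modulo `1` of `J` consecutive multiples of `θ` are `δ`-spaced, so that for each `i` at most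
two of them lie at a distance in `[i δ, (i + 1) δ)` from the integers. -/
theorem sum_Ico_le_of_spaced {θ δ X C : ℝ} {J : ℕ} (hδ : 0 < δ)
    (hθ : ∀ j : ℕ, 1 ≤ j → j < J → δ ≤ distNearestInt (θ * j))
    {F : ℕ → ℝ} (hC : 0 ≤ C) (hX : 0 ≤ X) (hF0 : ∀ j, 0 ≤ F j) (hFX : ∀ j, F j ≤ X)
    (hFC : ∀ j : ℕ, F j * distNearestInt (θ * j) ≤ C) (s : ℕ) :
    ∑ j ∈ Finset.Ico s (s + J), F j
      ≤ 2 * (X + C / δ * ∑ i ∈ Finset.range ⌊1 / (2 * δ)⌋₊, ((i : ℝ) + 1)⁻¹) := by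
  set K := ⌊1 / (2 * δ)⌋₊
  let r : ℕ → ℝ := fun j => θ * j - round (θ * j)
  have hr : ∀ j, |r j| = distNearestInt (θ * j) := fun j => rfl
  let w : ℕ → ℝ := fun i => if i = 0 then X else C / δ * (i : ℝ)⁻¹
  let φ : ℕ → Bool × ℕ := fun j => (decide (0 ≤ r j), ⌊|r j| / δ⌋₊)
  have hw : ∀ j, F j ≤ w (φ j).2 := by
    intro j
    simp only [w, φ]
    split_ifs with h
    · exact hFX j
    · have hi : (0 : ℝ) < ⌊|r j| / δ⌋₊ := by exact_mod_cast Nat.pos_of_ne_zero h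
      have h1 : (⌊|r j| / δ⌋₊ : ℝ) * δ ≤ |r j| := by
        rw [← le_div_iff₀ hδ]; exact Nat.floor_le (by positivity)
      rw [← div_eq_mul_inv, div_div, le_div_iff₀ (by positivity)]
      calc F j * (δ * ⌊|r j| / δ⌋₊) ≤ F j * |r j| :=
            mul_le_mul_of_nonneg_left (by linarith) (hF0 j)
        _ ≤ C := by rw [hr]; exact hFC j
  have hinj : Set.InjOn φ (Finset.Ico s (s + J) : Finset ℕ) := by
    have key : ∀ i j : ℕ, s ≤ i → i < j → j < s + J → φ i ≠ φ j := by
      intro i j hi hij hj h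
      have h1 := hθ (j - i) (by omega) (by omega)
      have h2 : distNearestInt (θ * ((j - i : ℕ) : ℝ)) ≤ |r j - r i| := by
        refine (distNearestInt_le_abs_sub _ (round (θ * j) - round (θ * i))).trans_eq ?_
        rw [Nat.cast_sub hij.le]
        congr 1
        push_cast
        simp only [r]
        ring
      simp only [φ, Prod.mk.injEq, decide_eq_decide] at h
      obtain ⟨hs, hf⟩ := h
      have a1 := Nat.floor_le (show 0 ≤ |r i| / δ by positivity)
      have a2 := Nat.lt_floor_add_one (|r i| / δ)
      have b1 := Nat.floor_le (show 0 ≤ |r j| / δ by positivity)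
      have b2 := Nat.lt_floor_add_one (|r j| / δ)
      rw [hf] at a1 a2
      generalize ⌊|r j| / δ⌋₊ = m at a1 a2 b1 b2
      rw [le_div_iff₀ hδ] at a1 b1
      rw [div_lt_iff₀ hδ] at a2 b2
      have h3 : |r j - r i| < δ := by
        by_cases h0 : 0 ≤ r i
        · rw [abs_of_nonneg h0] at a1 a2
          rw [abs_of_nonneg (hs.1 h0)] at b1 b2
          rw [abs_lt]; constructor <;> linarith
        · have h0' : ¬ 0 ≤ r j := fun h => h0 (hs.2 h)
          push Not at h0 h0'
          rw [abs_of_neg h0] at a1 a2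
          rw [abs_of_neg h0'] at b1 b2
          rw [abs_lt]; constructor <;> linarith
      linarith
    intro i hi j hj h
    simp only [Finset.coe_Ico, Set.mem_Ico] at hi hj
    rcases lt_trichotomy i j with h' | h' | h'
    · exact (key i j hi.1 h' hj.2 h).elim
    · exact h'
    · exact (key j i hj.1 h' hi.2 h.symm).elim
  have hmem : ∀ j, φ j ∈ (Finset.univ : Finset Bool) ×ˢ Finset.range (K + 1) := by
    intro j
    simp only [φ, Finset.mem_product, Finset.mem_univ, Finset.mem_range, true_and]
    refine Nat.lt_succ_of_le (Nat.floor_le_floor ?_)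
    rw [div_le_div_iff₀ hδ (by positivity), hr]
    nlinarith [distNearestInt_le_half (θ * j)]
  have hw0 : ∀ i, 0 ≤ w i := fun i => by
    simp only [w]; split_ifs
    · exact hX
    · positivity
  calc ∑ j ∈ Finset.Ico s (s + J), F j ≤ ∑ j ∈ Finset.Ico s (s + J), w (φ j).2 :=
        Finset.sum_le_sum fun j _ => hw j
    _ = ∑ p ∈ (Finset.Ico s (s + J)).image φ, w p.2 :=
        (Finset.sum_image (f := fun p : Bool × ℕ => w p.2) hinj).symm
    _ ≤ ∑ p ∈ (Finset.univ : Finset Bool) ×ˢ Finset.range (K + 1), w p.2 :=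
        Finset.sum_le_sum_of_subset_of_nonneg
          (Finset.image_subset_iff.2 fun j _ => hmem j) fun p _ _ => hw0 _
    _ = 2 * (X + C / δ * ∑ i ∈ Finset.range K, ((i : ℝ) + 1)⁻¹) := by
        rw [Finset.sum_product, Fintype.sum_bool, ← two_mul, Finset.sum_range_succ', Finset.mul_sum,
          add_comm X]
        simp [w]

/-- A sum over `[0, u)` is cut into blocks of length `J`, each of which is bounded by
`sum_Ico_le_of_spaced` with `δ = 1 / (6 J)`; the spacing loses nothing because `1 / δ` and `J` have
the same order. -/
theorem sum_range_le_of_spaced {θ X C : ℝ} {J N : ℕ} (hJ : 1 ≤ J) (hJN : 3 * J ≤ N)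
    (hθ : ∀ j : ℕ, 1 ≤ j → j ≤ J → 1 / (6 * (J : ℝ)) ≤ distNearestInt (θ * j))
    {F : ℕ → ℝ} (hC : 0 ≤ C) (hX : 0 ≤ X) (hF0 : ∀ j, 0 ≤ F j) (hFX : ∀ j, F j ≤ X)
    (hFC : ∀ j : ℕ, F j * distNearestInt (θ * j) ≤ C) (u : ℕ) :
    ∑ j ∈ Finset.range u, F j
      ≤ ((u : ℝ) / J + 1) * (2 * (X + C * (6 * J) * (1 + Real.log N))) := by
  have hJ0 : (0 : ℝ) < J := by exact_mod_cast hJ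
  have hblock : ∀ s, ∑ j ∈ Finset.Ico s (s + J), F j
      ≤ 2 * (X + C * (6 * J) * (1 + Real.log N)) := by
    intro s
    refine (sum_Ico_le_of_spaced (δ := 1 / (6 * (J : ℝ))) (by positivity)
      (fun j h h' => hθ j h h'.le) hC hX hF0 hFX hFC s).trans ?_
    have hK : ⌊1 / (2 * (1 / (6 * (J : ℝ))))⌋₊ = 3 * J := by
      rw [← Nat.floor_natCast (R := ℝ) (3 * J)]
      congr 1
      push_cast
      field_simp
      norm_num
    have hH : ∑ i ∈ Finset.range (3 * J), ((i : ℝ) + 1)⁻¹ ≤ 1 + Real.log N := by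
      refine le_trans (le_of_eq ?_) ((harmonic_le_one_add_log (3 * J)).trans ?_)
      · simp [harmonic]
      · have : ((3 * J : ℕ) : ℝ) ≤ N := by exact_mod_cast hJN
        have h3 : (0 : ℝ) < ((3 * J : ℕ) : ℝ) := by exact_mod_cast (by omega : 0 < 3 * J)
        linarith [Real.log_le_log h3 this]
    rw [hK, div_div_eq_mul_div, div_one]
    gcongr
  have hsub : ∀ m : ℕ, ∑ j ∈ Finset.range (m * J), F j
      ≤ m * (2 * (X + C * (6 * J) * (1 + Real.log N))) := by
    intro m
    induction m with
    | zero => simp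
    | succ m ih =>
      rw [Nat.succ_mul, Finset.range_eq_Ico,
        ← Finset.sum_Ico_consecutive F (Nat.zero_le (m * J)) (Nat.le_add_right (m * J) J),
        ← Finset.range_eq_Ico]
      push_cast
      linarith [hblock (m * J)]
  have hB : 0 ≤ 2 * (X + C * (6 * J) * (1 + Real.log N)) := by
    have : 0 ≤ Real.log N := Real.log_natCast_nonneg N
    positivity
  have hu : u ≤ (u / J + 1) * J := by
    rw [mul_comm]; exact (Nat.lt_mul_div_succ u hJ).le
  calc ∑ j ∈ Finset.range u, F j ≤ ∑ j ∈ Finset.range ((u / J + 1) * J), F j :=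
        Finset.sum_le_sum_of_subset_of_nonneg (Finset.range_mono hu) fun j _ _ => hF0 j
    _ ≤ _ := hsub _
    _ ≤ _ := by
        refine mul_le_mul_of_nonneg_right ?_ hB
        push_cast
        linarith [Nat.cast_div_le (α := ℝ) (m := u) (n := J)]

/-! ### Dirichlet convolutions and divisor sums -/

theorem sum_Ioc_inv_le (N : ℕ) : ∑ n ∈ Finset.Ioc 0 N, ((n : ℝ))⁻¹ ≤ 1 + Real.log N := by
  refine le_trans (le_of_eq ?_) (harmonic_le_one_add_log N)
  rw [harmonic_eq_sum_Icc]
  push_cast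
  rfl

theorem sum_Ioc_sum_divisorsAntidiagonal {R : Type*} [AddCommMonoid R] (G : ℕ × ℕ → R) (N : ℕ) :
    ∑ n ∈ Finset.Ioc 0 N, ∑ x ∈ n.divisorsAntidiagonal, G x
      = ∑ x ∈ Finset.Ioc 0 N ×ˢ Finset.Ioc 0 N with x.1 * x.2 ≤ N, G x := by
  trans ∑ n ∈ Finset.Ioc 0 N, ∑ x ∈ Finset.Ioc 0 N ×ˢ Finset.Ioc 0 N with x.1 * x.2 = n, G x
  · refine Finset.sum_congr rfl fun n hn ↦ ?_
    simp only [Finset.mem_Ioc] at hn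
    rw [Nat.divisorsAntidiagonal_eq_prod_filter_of_le hn.1.ne' hn.2]
  · simp_rw [Finset.sum_filter]
    rw [Finset.sum_comm]
    refine Finset.sum_congr rfl fun x hx ↦ ?_
    simp only [Finset.mem_product, Finset.mem_Ioc] at hx
    rw [Finset.sum_ite_eq]
    simp [Nat.mul_pos hx.1.1 hx.2.1]

theorem sum_Ioc_mul_mul_eq_sum_sum (f g : ArithmeticFunction ℝ) (F : ℕ → ℂ) (N : ℕ) :
    ∑ n ∈ Finset.Ioc 0 N, ((f * g) n : ℂ) * F n
      = ∑ d ∈ Finset.Ioc 0 N, (f d : ℂ) * ∑ l ∈ Finset.Ioc 0 (N / d), (g l : ℂ) * F (d * l) := by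
  have h1 : ∀ n ∈ Finset.Ioc 0 N, ((f * g) n : ℂ) * F n
      = ∑ x ∈ n.divisorsAntidiagonal, (f x.1 : ℂ) * ((g x.2 : ℂ) * F (x.1 * x.2)) := by
    intro n _
    rw [ArithmeticFunction.mul_apply, Complex.ofReal_sum, Finset.sum_mul]
    refine Finset.sum_congr rfl fun x hx => ?_
    rw [(Nat.mem_divisorsAntidiagonal.1 hx).1]
    push_cast
    ring
  rw [Finset.sum_congr rfl h1, sum_Ioc_sum_divisorsAntidiagonal
    (fun x => (f x.1 : ℂ) * ((g x.2 : ℂ) * F (x.1 * x.2))), Finset.sum_filter, Finset.sum_product]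
  refine Finset.sum_congr rfl fun d hd => ?_
  rw [Finset.mul_sum, ← Finset.sum_filter]
  refine Finset.sum_congr ?_ fun _ _ => rfl
  ext l
  simp only [Finset.mem_filter, Finset.mem_Ioc] at hd ⊢
  rw [Nat.le_div_iff_mul_le hd.1, mul_comm d l]
  constructor
  · rintro ⟨⟨h, _⟩, h'⟩; exact ⟨h, h'⟩
  · rintro ⟨h, h'⟩; exact ⟨⟨h, le_trans (Nat.le_mul_of_pos_right l hd.1) h'⟩, h'⟩

/-- A sum over factorizations `n = x₁ x₂ ≤ N` is dominated by the sum over all pairs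
`x₁, x₂ ≤ N`. Applied with `f(n) = 1 / n` and then with `f(n) = d(n) / n`, where `d` is the divisor
function, it gives the mean values of `d` and `d ^ 2`. -/
theorem sum_Ioc_sum_divisorsAntidiagonal_mul_le {f : ℕ → ℝ} (hf : ∀ n, 0 ≤ f n) (N : ℕ) :
    ∑ n ∈ Finset.Ioc 0 N, ∑ x ∈ n.divisorsAntidiagonal, f x.1 * f x.2
      ≤ (∑ n ∈ Finset.Ioc 0 N, f n) ^ 2 := by
  rw [sum_Ioc_sum_divisorsAntidiagonal (fun x => f x.1 * f x.2), sq, Finset.sum_mul_sum,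
    ← Finset.sum_product']
  exact Finset.sum_le_sum_of_subset_of_nonneg (Finset.filter_subset _ _)
    fun x _ _ => mul_nonneg (hf _) (hf _)

theorem card_divisors_mul_le (m n : ℕ) :
    (m * n).divisors.card ≤ m.divisors.card * n.divisors.card := by
  open scoped Pointwise in
  rw [Nat.divisors_mul]
  exact Finset.card_mul_le

theorem card_divisorsAntidiagonal (n : ℕ) : n.divisorsAntidiagonal.card = n.divisors.card := by
  rw [← Nat.map_div_right_divisors, Finset.card_map]

theorem sum_card_divisors_div_le (N : ℕ) :
    ∑ n ∈ Finset.Ioc 0 N, (n.divisors.card : ℝ) * (n : ℝ)⁻¹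
      ≤ (∑ n ∈ Finset.Ioc 0 N, (n : ℝ)⁻¹) ^ 2 := by
  refine le_trans (le_of_eq ?_)
    (sum_Ioc_sum_divisorsAntidiagonal_mul_le (f := fun n => (n : ℝ)⁻¹) (fun n => by positivity) N)
  refine Finset.sum_congr rfl fun n _ => ?_
  rw [← card_divisorsAntidiagonal, ← nsmul_eq_mul, ← Finset.sum_const]
  refine Finset.sum_congr rfl fun x hx => ?_
  rw [← (Nat.mem_divisorsAntidiagonal.1 hx).1, Nat.cast_mul, mul_inv]

theorem sum_card_divisors_sq_div_le (N : ℕ) :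
    ∑ n ∈ Finset.Ioc 0 N, (n.divisors.card : ℝ) ^ 2 * (n : ℝ)⁻¹
      ≤ (∑ n ∈ Finset.Ioc 0 N, (n : ℝ)⁻¹) ^ 4 := by
  have h1 := sum_Ioc_sum_divisorsAntidiagonal_mul_le
    (f := fun n => (n.divisors.card : ℝ) * (n : ℝ)⁻¹) (fun n => by positivity) N
  have h0 : 0 ≤ ∑ n ∈ Finset.Ioc 0 N, (n.divisors.card : ℝ) * (n : ℝ)⁻¹ :=
    Finset.sum_nonneg fun n _ => by positivity
  calc _ ≤ _ := Finset.sum_le_sum fun n _ => ?_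
    _ ≤ _ := h1
    _ ≤ ((∑ n ∈ Finset.Ioc 0 N, (n : ℝ)⁻¹) ^ 2) ^ 2 :=
        pow_le_pow_left₀ h0 (sum_card_divisors_div_le N) 2
    _ = _ := by ring
  rw [sq, mul_assoc]
  nth_rewrite 1 [← card_divisorsAntidiagonal]
  rw [← nsmul_eq_mul, ← Finset.sum_const]
  refine Finset.sum_le_sum fun x hx => ?_
  rw [← (Nat.mem_divisorsAntidiagonal.1 hx).1, Nat.cast_mul, mul_inv]
  have : ((x.1 * x.2).divisors.card : ℝ) ≤ x.1.divisors.card * x.2.divisors.card := by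
    exact_mod_cast card_divisors_mul_le x.1 x.2
  calc _ ≤ ((x.1.divisors.card : ℝ) * x.2.divisors.card) * ((x.1 : ℝ)⁻¹ * (x.2 : ℝ)⁻¹) := by gcongr
    _ = _ := by ring

/-! ### Linear sums -/

/-- A linear (type I) sum: if the coefficients `a` live on `d ≤ D ≤ J` and every `θ d` with
`d ≤ J` is `δ`-far from the integers, then each inner geometric sum is `≤ w(N) / δ`. -/
theorem norm_type_one_sum_le {θ δ A : ℝ} {J D : ℕ} (hδ : 0 < δ) (hDJ : D ≤ J)
    (hθ : ∀ j : ℕ, 1 ≤ j → j ≤ J → δ ≤ distNearestInt (θ * j))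
    {a w : ArithmeticFunction ℝ} (hA : 0 ≤ A) (ha : ∀ d, d ≤ D → |a d| ≤ A)
    (haD : ∀ d, D < d → a d = 0) (hw : Monotone w) (N : ℕ) :
    ‖∑ n ∈ Finset.Ioc 0 N, ((a * w) n : ℂ) * eChar (θ * n)‖ ≤ D * (A * (w N / δ)) := by
  have hw0 : 0 ≤ w 0 := by simp
  have hwN : 0 ≤ w N := hw0.trans (hw (Nat.zero_le N))
  rw [sum_Ioc_mul_mul_eq_sum_sum a w (fun n => eChar (θ * n))]
  have h1 : ∀ d ∈ Finset.Ioc 0 N,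
      ‖(a d : ℂ) * ∑ l ∈ Finset.Ioc 0 (N / d), (w l : ℂ) * eChar (θ * ((d * l : ℕ) : ℝ))‖
        ≤ if d ≤ D then A * (w N / δ) else 0 := by
    intro d hd
    rw [Finset.mem_Ioc] at hd
    split_ifs with h
    · rw [norm_mul, Complex.norm_real, Real.norm_eq_abs]
      refine mul_le_mul (ha d h) ?_ (norm_nonneg _) hA
      rw [le_div_iff₀ hδ]
      have h2 := norm_sum_monotone_mul_eChar_mul_dist_le hw hw0 (θ * d) (N / d)
      simp only [Nat.cast_mul, ← mul_assoc]
      exact (mul_le_mul_of_nonneg_left (hθ d hd.1 (h.trans hDJ)) (norm_nonneg _)).trans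
        (h2.trans (hw (Nat.div_le_self N d)))
    · simp [haD d (not_le.1 h)]
  refine (norm_sum_le_of_le _ h1).trans ?_
  rw [← Finset.sum_filter, Finset.sum_const, nsmul_eq_mul]
  refine mul_le_mul_of_nonneg_right ?_ (by positivity)
  have : (Finset.Ioc 0 N).filter (· ≤ D) ⊆ Finset.Ioc 0 D := by
    intro d; simp only [Finset.mem_filter, Finset.mem_Ioc]; omega
  exact_mod_cast (Finset.card_le_card this).trans_eq (by simp)

/-! ### Bilinear sums -/

/-- The geometric sum `∑_{v ≤ Y} v e(x v)` with linear weights. -/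
noncomputable def linearWeightSum (x : ℝ) (Y : ℕ) : ℂ :=
  ∑ v ∈ Finset.Ioc 0 Y, ((v : ℝ) : ℂ) * eChar (x * v)

theorem norm_linearWeightSum_neg (x : ℝ) (Y : ℕ) :
    ‖linearWeightSum (-x) Y‖ = ‖linearWeightSum x Y‖ := by
  rw [← Complex.norm_conj (linearWeightSum x Y)]
  congr 1
  simp only [linearWeightSum, map_sum, map_mul, conj_eChar, Complex.conj_ofReal, neg_mul]

theorem norm_linearWeightSum_le (x : ℝ) (Y : ℕ) : ‖linearWeightSum x Y‖ ≤ (Y : ℝ) ^ 2 := by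
  have : ∀ v ∈ Finset.Ioc 0 Y, ‖((v : ℝ) : ℂ) * eChar (x * v)‖ ≤ (Y : ℝ) := by
    intro v hv
    rw [norm_mul, norm_eChar, mul_one, Complex.norm_real, Real.norm_natCast]
    exact_mod_cast (Finset.mem_Ioc.1 hv).2
  refine (norm_sum_le_of_le _ this).trans_eq ?_
  simp [sq]

theorem norm_linearWeightSum_mul_dist_le (x : ℝ) (Y : ℕ) :
    ‖linearWeightSum x Y‖ * distNearestInt x ≤ Y :=
  norm_sum_monotone_mul_eChar_mul_dist_le (w := fun n => (n : ℝ)) Nat.mono_cast (by simp) x Y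

/-- Opening the square in the second moment of `T(v) = ∑_u g(u) e(θ u v)`, `u v ≤ N`, and summing
over `v` first. The weight `v` compensates for the length `N / v` of the sum over `u`. -/
theorem sum_mul_norm_sq_le (θ : ℝ) {g : ℕ → ℝ} {A : ℝ} (hg : ∀ u, |g u| ≤ A) (s : Finset ℕ)
    (hs : ∀ u ∈ s, 0 < u) (N : ℕ) :
    ∑ v ∈ Finset.Ioc 0 N,
        (v : ℝ) * ‖∑ u ∈ s with u * v ≤ N, (g u : ℂ) * eChar (θ * (v * u))‖ ^ 2
      ≤ A ^ 2 * ∑ u ∈ s, ∑ u' ∈ s, ‖linearWeightSum (θ * (u - u')) (N / max u u')‖ := by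
  have hA : 0 ≤ A := (abs_nonneg _).trans (hg 0)
  have h1 : ((∑ v ∈ Finset.Ioc 0 N,
        (v : ℝ) * ‖∑ u ∈ s with u * v ≤ N, (g u : ℂ) * eChar (θ * (v * u))‖ ^ 2 : ℝ) : ℂ)
      = ∑ u ∈ s, ∑ u' ∈ s,
        ((g u * g u' : ℝ) : ℂ) * linearWeightSum (θ * (u - u')) (N / max u u') := by
    have hv : ∀ v ∈ Finset.Ioc 0 N,
        ((v : ℝ) : ℂ) * ((‖∑ u ∈ s with u * v ≤ N, (g u : ℂ) * eChar (θ * (v * u))‖ : ℝ) : ℂ) ^ 2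
          = ∑ u ∈ s, ∑ u' ∈ s, if u * v ≤ N ∧ u' * v ≤ N then
            ((g u * g u' : ℝ) : ℂ) * (((v : ℝ) : ℂ) * eChar (θ * (u - u') * v)) else 0 := by
      intro v _
      rw [← Complex.mul_conj', map_sum, Finset.sum_mul_sum, Finset.mul_sum, Finset.sum_filter]
      refine Finset.sum_congr rfl fun u _ => ?_
      split_ifs with hu
      · rw [Finset.mul_sum, Finset.sum_filter]
        refine Finset.sum_congr rfl fun u' _ => ?_
        by_cases hu' : u' * v ≤ N
        · simp only [hu, hu', and_self, if_true, map_mul, conj_eChar, Complex.conj_ofReal]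
          rw [show θ * ((u : ℝ) - u') * v = θ * (v * u) + -(θ * (v * u')) by ring, eChar_add]
          push_cast
          ring
        · simp [hu']
      · simp [hu]
    rw [Complex.ofReal_sum]
    simp only [Complex.ofReal_mul, Complex.ofReal_pow]
    simp only [Complex.ofReal_mul] at hv
    rw [Finset.sum_congr rfl hv, Finset.sum_comm]
    refine Finset.sum_congr rfl fun u hu => ?_
    rw [Finset.sum_comm]
    refine Finset.sum_congr rfl fun u' hu' => ?_
    rw [← Finset.sum_filter, linearWeightSum, Finset.mul_sum]
    refine Finset.sum_congr ?_ fun _ _ => rfl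
    ext v
    have hpos : 0 < max u u' := lt_max_of_lt_left (hs u hu)
    simp only [Finset.mem_filter, Finset.mem_Ioc, Nat.le_div_iff_mul_le hpos, mul_comm v,
      max_mul, max_le_iff]
    constructor
    · rintro ⟨⟨h, _⟩, h'⟩; exact ⟨h, h'⟩
    · rintro ⟨h, h'⟩
      exact ⟨⟨h, le_trans (Nat.le_mul_of_pos_left v (hs u hu)) h'.1⟩, h'⟩
  refine (le_abs_self _).trans ?_
  rw [← Real.norm_eq_abs, ← Complex.norm_real, h1, Finset.mul_sum]
  refine norm_sum_le_of_le _ fun u _ => ?_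
  rw [Finset.mul_sum]
  refine norm_sum_le_of_le _ fun u' _ => ?_
  rw [norm_mul, Complex.norm_real, Real.norm_eq_abs, abs_mul, sq]
  gcongr
  exacts [hg u, hg u']

/-- By symmetry it is enough to sum over the pairs with `u' ≤ u`, where `u - u'` runs through
distinct elements of `[0, u)`. -/
theorem sum_sum_linearWeightSum_le (θ : ℝ) (s : Finset ℕ) (hs : ∀ u ∈ s, 0 < u) (N : ℕ) :
    ∑ u ∈ s, ∑ u' ∈ s, ‖linearWeightSum (θ * (u - u')) (N / max u u')‖
      ≤ 2 * ∑ u ∈ s, ∑ j ∈ Finset.range u, ‖linearWeightSum (θ * j) (N / u)‖ := by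
  set S : ℕ → ℕ → ℝ := fun u u' => ‖linearWeightSum (θ * (u - u')) (N / max u u')‖ with hS
  have hsymm : ∀ u u', S u u' = S u' u := by
    intro u u'
    simp only [hS]
    rw [max_comm, ← norm_linearWeightSum_neg]
    congr 3
    ring
  have hS0 : ∀ u u', 0 ≤ S u u' := fun _ _ => norm_nonneg _
  have h1 : ∑ u ∈ s, ∑ u' ∈ s, S u u' ≤ ∑ u ∈ s, ∑ u' ∈ s, (if u' ≤ u then S u u' else 0)
      + ∑ u ∈ s, ∑ u' ∈ s, (if u ≤ u' then S u u' else 0) := by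
    rw [← Finset.sum_add_distrib]
    refine Finset.sum_le_sum fun u _ => ?_
    rw [← Finset.sum_add_distrib]
    refine Finset.sum_le_sum fun u' _ => ?_
    have := hS0 u u'
    split_ifs <;> linarith
  have h2 : ∑ u ∈ s, ∑ u' ∈ s, (if u ≤ u' then S u u' else 0)
      = ∑ u ∈ s, ∑ u' ∈ s, (if u' ≤ u then S u u' else 0) := by
    rw [Finset.sum_comm]
    exact Finset.sum_congr rfl fun u _ => Finset.sum_congr rfl fun u' _ => by rw [hsymm]
  rw [h2, ← two_mul] at h1
  refine h1.trans (mul_le_mul_of_nonneg_left (Finset.sum_le_sum fun u hu => ?_) zero_le_two)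
  rw [← Finset.sum_filter]
  have hinj : Set.InjOn (fun u' => u - u') ((s.filter (· ≤ u) : Finset ℕ) : Set ℕ) := by
    intro a ha b hb hab
    simp only [Finset.coe_filter, Set.mem_ofPred_eq] at ha hb
    dsimp only at hab
    omega
  calc ∑ u' ∈ s with u' ≤ u, S u u'
      = ∑ u' ∈ s with u' ≤ u, ‖linearWeightSum (θ * ((u - u' : ℕ) : ℝ)) (N / u)‖ := by
        refine Finset.sum_congr rfl fun u' hu' => ?_
        have hle := (Finset.mem_filter.1 hu').2
        simp only [hS]
        rw [max_eq_left hle, Nat.cast_sub hle]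
    _ = ∑ j ∈ (s.filter (· ≤ u)).image (fun u' => u - u'),
          ‖linearWeightSum (θ * (j : ℝ)) (N / u)‖ :=
        (Finset.sum_image (f := fun j : ℕ => ‖linearWeightSum (θ * (j : ℝ)) (N / u)‖) hinj).symm
    _ ≤ _ := by
        refine Finset.sum_le_sum_of_subset_of_nonneg ?_ fun _ _ _ => norm_nonneg _
        intro j hj
        obtain ⟨u', hu', rfl⟩ := Finset.mem_image.1 hj
        have := hs u' (Finset.mem_filter.1 hu').1
        have := hs u hu
        exact Finset.mem_range.2 (by omega)

/-- The diagonal and off-diagonal terms of the type II sum together: for each `u` the inner sum is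
controlled by `sum_range_le_of_spaced` with `X = (N / u) ^ 2` and `C = N / u`. -/
theorem sum_sum_linearWeightSum_le_of_spaced {θ : ℝ} {J V N : ℕ} (hV : 1 ≤ V) (hVJ : V ≤ J)
    (hJN : 3 * J ≤ N) (hJVN : J * V ≤ N)
    (hθ : ∀ j : ℕ, 1 ≤ j → j ≤ J → 1 / (6 * (J : ℝ)) ≤ distNearestInt (θ * j)) :
    ∑ u ∈ Finset.Ioc V (N / V), ∑ j ∈ Finset.range u, ‖linearWeightSum (θ * j) (N / u)‖
      ≤ 28 * (1 + Real.log N) ^ 2 * N ^ 2 / V := by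
  have hJ : 1 ≤ J := hV.trans hVJ
  have hN1 : 1 ≤ N := by omega
  set L := 1 + Real.log N with hL
  have hL1 : 1 ≤ L := by have := Real.log_natCast_nonneg N; linarith
  have hV0 : (0 : ℝ) < V := by exact_mod_cast hV
  have hJ0 : (0 : ℝ) < J := by exact_mod_cast hJ
  have hN0 : (0 : ℝ) < N := by exact_mod_cast hN1
  have hVJ' : (V : ℝ) ≤ J := by exact_mod_cast hVJ
  have hJVN' : (J : ℝ) * V ≤ N := by exact_mod_cast hJVN
  have h1 : ∀ u ∈ Finset.Ioc V (N / V),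
      ∑ j ∈ Finset.range u, ‖linearWeightSum (θ * j) (N / u)‖
        ≤ 2 * (N ^ 2 / J + N ^ 2 / V + 6 * (J * N * L)) * (u : ℝ)⁻¹ + 12 * (N * L) := by
    intro u hu
    rw [Finset.mem_Ioc] at hu
    have hu0 : (0 : ℝ) < u := by exact_mod_cast (by omega : 0 < u)
    have hVu : (V : ℝ) ≤ u := by exact_mod_cast hu.1.le
    have hy : ((N / u : ℕ) : ℝ) ≤ N / u := Nat.cast_div_le
    have := sum_range_le_of_spaced (X := (N / u : ℝ) ^ 2) (C := (N / u : ℝ)) hJ hJN hθ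
      (by positivity) (by positivity)
      (F := fun j => ‖linearWeightSum (θ * j) (N / u)‖) (fun _ => norm_nonneg _)
      (fun j => (norm_linearWeightSum_le _ _).trans (pow_le_pow_left₀ (by positivity) hy 2))
      (fun j => (norm_linearWeightSum_mul_dist_le _ _).trans hy) u
    refine this.trans ?_
    rw [← hL]
    have e1 : ((u : ℝ) / J + 1) * (2 * ((N / u : ℝ) ^ 2 + N / u * (6 * J) * L))
        = 2 * (N ^ 2 / J + N ^ 2 * (u : ℝ)⁻¹ + 6 * (J * N * L)) * (u : ℝ)⁻¹ + 12 * (N * L) := by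
      field_simp
      ring
    rw [e1]
    have : (u : ℝ)⁻¹ ≤ (V : ℝ)⁻¹ := inv_anti₀ hV0 hVu
    rw [div_eq_mul_inv _ (V : ℝ)]
    gcongr
  refine (Finset.sum_le_sum h1).trans ?_
  rw [Finset.sum_add_distrib, ← Finset.mul_sum, Finset.sum_const, nsmul_eq_mul]
  have h2 : ∑ u ∈ Finset.Ioc V (N / V), (u : ℝ)⁻¹ ≤ L := by
    refine le_trans (Finset.sum_le_sum_of_subset_of_nonneg ?_ fun _ _ _ => by positivity)
      (sum_Ioc_inv_le N)
    intro u hu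
    rw [Finset.mem_Ioc] at hu ⊢
    exact ⟨by omega, hu.2.trans (Nat.div_le_self N V)⟩
  have h3 : ((Finset.Ioc V (N / V)).card : ℝ) ≤ N / V := by
    refine le_trans ?_ (Nat.cast_div_le (m := N) (n := V))
    rw [Nat.card_Ioc]
    exact_mod_cast Nat.sub_le _ _
  have h4 : (N : ℝ) ^ 2 / J ≤ N ^ 2 / V := by gcongr
  have h5 : (J : ℝ) * N * L ≤ L * (N ^ 2 / V) := by
    have : (J : ℝ) ≤ N / V := (le_div_iff₀ hV0).2 hJVN'
    calc (J : ℝ) * N * L ≤ N / V * N * L := by gcongr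
      _ = _ := by ring
  set Z : ℝ := N ^ 2 / V with hZ
  have hZ0 : 0 ≤ Z := by positivity
  calc 2 * ((N : ℝ) ^ 2 / J + Z + 6 * (J * N * L)) * ∑ u ∈ Finset.Ioc V (N / V), (u : ℝ)⁻¹
        + ((Finset.Ioc V (N / V)).card : ℝ) * (12 * (N * L))
      ≤ 2 * (Z + Z + 6 * (L * Z)) * L + N / V * (12 * (N * L)) := by gcongr
    _ = 4 * (Z * L) + 12 * (Z * L ^ 2) + 12 * (Z * L) := by rw [hZ]; ring
    _ ≤ 28 * (Z * L ^ 2) := by nlinarith [mul_nonneg hZ0 (by linarith : 0 ≤ L)]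
    _ = _ := by rw [hZ]; ring

/-- A bilinear (type II) sum, by the Cauchy–Schwarz inequality with weights `1 / v` and `v`. -/
theorem norm_type_two_sum_le {θ A : ℝ} {J V N : ℕ} (hV : 1 ≤ V) (hVJ : V ≤ J)
    (hJN : 3 * J ≤ N) (hJVN : J * V ≤ N)
    (hθ : ∀ j : ℕ, 1 ≤ j → j ≤ J → 1 / (6 * (J : ℝ)) ≤ distNearestInt (θ * j))
    {b g : ArithmeticFunction ℝ} (hb : ∀ v, |b v| ≤ v.divisors.card) (hbV : ∀ v, v ≤ V → b v = 0)
    (hg : ∀ u, u ≤ N → |g u| ≤ A) (hgV : ∀ u, u ≤ V → g u = 0) :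
    ‖∑ n ∈ Finset.Ioc 0 N, ((b * g) n : ℂ) * eChar (θ * n)‖ ^ 2
      ≤ 56 * A ^ 2 * (1 + Real.log N) ^ 6 * N ^ 2 / V := by
  have hA : 0 ≤ A := (abs_nonneg _).trans (hg 0 (Nat.zero_le N))
  set L := 1 + Real.log N with hL
  have hL0 : 0 ≤ L := by have := Real.log_natCast_nonneg N; linarith
  set s := Finset.Ioc V (N / V)
  -- Truncating `g` at `N` makes its bound uniform and leaves the sums unchanged.
  let g' : ℕ → ℝ := fun u => if u ≤ N then g u else 0
  have hg' : ∀ u, |g' u| ≤ A := fun u => by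
    simp only [g']; split_ifs with h
    · exact hg u h
    · simpa using hA
  let T : ℕ → ℂ := fun v => ∑ u ∈ s with u * v ≤ N, (g' u : ℂ) * eChar (θ * (v * u))
  have h1 : ∑ n ∈ Finset.Ioc 0 N, ((b * g) n : ℂ) * eChar (θ * n)
      = ∑ v ∈ Finset.Ioc 0 N, (b v : ℂ) * T v := by
    rw [sum_Ioc_mul_mul_eq_sum_sum b g (fun n => eChar (θ * n))]
    refine Finset.sum_congr rfl fun v hv => ?_
    rw [Finset.mem_Ioc] at hv
    rcases le_or_gt v V with h | h
    · simp [hbV v h]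
    congr 1
    symm
    refine (Finset.sum_subset_zero_on_sdiff ?_ ?_ ?_)
    · intro u hu
      simp only [s, Finset.mem_filter, Finset.mem_Ioc] at hu
      rw [Finset.mem_Ioc, Nat.le_div_iff_mul_le hv.1]
      exact ⟨by omega, hu.2⟩
    · intro u hu
      simp only [s, Finset.mem_sdiff, Finset.mem_filter, Finset.mem_Ioc] at hu
      obtain ⟨⟨hu0, huv⟩, hn⟩ := hu
      have : u ≤ V := by
        by_contra! hVu
        exact hn ⟨⟨hVu, huv.trans (Nat.div_le_div_left h.le hV)⟩,
          (Nat.le_div_iff_mul_le hv.1).1 huv⟩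
      simp [hgV u this]
    · intro u hu
      simp only [s, Finset.mem_filter, Finset.mem_Ioc] at hu
      have : u ≤ N := hu.1.2.trans (Nat.div_le_self N V)
      simp only [g', if_pos this]
      push_cast
      ring
  rw [h1]
  have h2 : ‖∑ v ∈ Finset.Ioc 0 N, (b v : ℂ) * T v‖ ^ 2
      ≤ (∑ v ∈ Finset.Ioc 0 N, (v.divisors.card : ℝ) ^ 2 * (v : ℝ)⁻¹)
        * ∑ v ∈ Finset.Ioc 0 N, (v : ℝ) * ‖T v‖ ^ 2 := by
    calc ‖∑ v ∈ Finset.Ioc 0 N, (b v : ℂ) * T v‖ ^ 2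
        ≤ (∑ v ∈ Finset.Ioc 0 N, (v.divisors.card : ℝ) * ‖T v‖) ^ 2 := by
          refine pow_le_pow_left₀ (norm_nonneg _) (norm_sum_le_of_le _ fun v _ => ?_) 2
          rw [norm_mul, Complex.norm_real, Real.norm_eq_abs]
          exact mul_le_mul_of_nonneg_right (hb v) (norm_nonneg _)
      _ ≤ _ := by
          refine Finset.sum_sq_le_sum_mul_sum_of_sq_le_mul _ (fun v _ => by positivity)
            (fun v _ => by positivity) fun v hv => le_of_eq ?_
          have : (v : ℝ) ≠ 0 := by exact_mod_cast (Finset.mem_Ioc.1 hv).1.ne'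
          field_simp
  have hs : ∀ u ∈ s, 0 < u := fun u hu => (Nat.zero_le V).trans_lt (Finset.mem_Ioc.1 hu).1
  have h3 : ∑ v ∈ Finset.Ioc 0 N, (v : ℝ) * ‖T v‖ ^ 2
      ≤ A ^ 2 * (2 * (28 * L ^ 2 * N ^ 2 / V)) := by
    refine (sum_mul_norm_sq_le θ hg' s hs N).trans ?_
    gcongr
    refine (sum_sum_linearWeightSum_le θ s hs N).trans ?_
    gcongr
    exact sum_sum_linearWeightSum_le_of_spaced hV hVJ hJN hJVN hθ
  have h4 : ∑ v ∈ Finset.Ioc 0 N, (v.divisors.card : ℝ) ^ 2 * (v : ℝ)⁻¹ ≤ L ^ 4 :=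
    (sum_card_divisors_sq_div_le N).trans
      (pow_le_pow_left₀ (Finset.sum_nonneg fun _ _ => by positivity) (sum_Ioc_inv_le N) 4)
  calc _ ≤ _ := h2
    _ ≤ L ^ 4 * (A ^ 2 * (2 * (28 * L ^ 2 * N ^ 2 / V))) :=
        mul_le_mul h4 h3 (Finset.sum_nonneg fun _ _ => by positivity) (by positivity)
    _ = _ := by ring

/-! ### Vaughan's identity -/

/-- The restriction of an arithmetic function to the integers `n ≤ V`. -/
def truncate (f : ArithmeticFunction ℝ) (V : ℕ) : ArithmeticFunction ℝ :=
  ⟨fun n => if n ≤ V then f n else 0, by simp⟩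

theorem truncate_apply_of_le (f : ArithmeticFunction ℝ) {n V : ℕ} (h : n ≤ V) :
    truncate f V n = f n := if_pos h

theorem truncate_apply_of_lt (f : ArithmeticFunction ℝ) {n V : ℕ} (h : V < n) :
    truncate f V n = 0 := if_neg (not_le.2 h)

theorem abs_truncate_le (f : ArithmeticFunction ℝ) (V n : ℕ) : |truncate f V n| ≤ |f n| := by
  rcases le_or_gt n V with h | h
  · rw [truncate_apply_of_le f h]
  · rw [truncate_apply_of_lt f h, abs_zero]; exact abs_nonneg _

theorem arithmeticFunction_sub_apply (f g : ArithmeticFunction ℝ) (n : ℕ) :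
    (f - g) n = f n - g n := by
  rw [sub_eq_add_neg, ArithmeticFunction.add_apply, sub_eq_add_neg]
  rfl

theorem abs_sub_truncate_le (f : ArithmeticFunction ℝ) (V n : ℕ) :
    |(f - truncate f V) n| ≤ |f n| := by
  rw [arithmeticFunction_sub_apply]
  rcases le_or_gt n V with h | h
  · rw [truncate_apply_of_le f h, sub_self, abs_zero]; exact abs_nonneg _
  · rw [truncate_apply_of_lt f h, sub_zero]

theorem sub_truncate_apply_of_le (f : ArithmeticFunction ℝ) {n V : ℕ} (h : n ≤ V) :
    (f - truncate f V) n = 0 := by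
  rw [arithmeticFunction_sub_apply, truncate_apply_of_le f h, sub_self]

/-- The Möbius function with real values. -/
abbrev realMoebius : ArithmeticFunction ℝ := ((μ : ArithmeticFunction ℤ) : ArithmeticFunction ℝ)

/-- The constant function `1` on the positive integers, with real values. -/
abbrev realZeta : ArithmeticFunction ℝ := ((ζ : ArithmeticFunction ℕ) : ArithmeticFunction ℝ)

theorem abs_realMoebius_le_one (n : ℕ) : |realMoebius n| ≤ 1 := by
  rw [ArithmeticFunction.intCoe_apply]
  exact_mod_cast ArithmeticFunction.abs_moebius_le_one

theorem abs_vonMangoldt_le_log (n : ℕ) : |Λ n| ≤ Real.log n := by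
  rw [abs_of_nonneg ArithmeticFunction.vonMangoldt_nonneg]
  exact ArithmeticFunction.vonMangoldt_le_log

/-- Vaughan's identity. -/
theorem vonMangoldt_eq_vaughan (V : ℕ) :
    Λ = truncate Λ V + truncate realMoebius V * ArithmeticFunction.log
      - truncate realMoebius V * truncate Λ V * realZeta
      + (realMoebius - truncate realMoebius V) * realZeta * (Λ - truncate Λ V) := by
  have h1 : realMoebius * realZeta = 1 := ArithmeticFunction.coe_moebius_mul_coe_zeta
  have h2 : Λ * realZeta = ArithmeticFunction.log := ArithmeticFunction.vonMangoldt_mul_zeta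
  rw [← h2]
  linear_combination (truncate Λ V - Λ) * h1

theorem abs_sub_truncate_moebius_mul_zeta_le (V n : ℕ) :
    |((realMoebius - truncate realMoebius V) * realZeta) n| ≤ n.divisors.card := by
  rw [ArithmeticFunction.coe_mul_zeta_apply]
  refine (Finset.abs_sum_le_sum_abs _ _).trans ?_
  rw [Finset.cast_card]
  exact Finset.sum_le_sum fun d _ => (abs_sub_truncate_le _ V d).trans (abs_realMoebius_le_one d)

theorem sub_truncate_moebius_mul_zeta_of_le {V n : ℕ} (h : n ≤ V) :
    ((realMoebius - truncate realMoebius V) * realZeta) n = 0 := by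
  rw [ArithmeticFunction.coe_mul_zeta_apply]
  refine Finset.sum_eq_zero fun d hd => sub_truncate_apply_of_le _ ?_
  exact (Nat.divisor_le hd).trans h

theorem abs_truncate_mul_truncate_le (V n : ℕ) :
    |(truncate realMoebius V * truncate Λ V) n| ≤ Real.log n := by
  rw [ArithmeticFunction.mul_apply, ← ArithmeticFunction.vonMangoldt_sum,
    ← Nat.sum_divisorsAntidiagonal' (f := fun _ e => Λ e)]
  refine (Finset.abs_sum_le_sum_abs _ _).trans (Finset.sum_le_sum fun x _ => ?_)
  rw [abs_mul, ← one_mul (Λ x.2)]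
  refine mul_le_mul ((abs_truncate_le _ V _).trans (abs_realMoebius_le_one _)) ?_
    (abs_nonneg _) zero_le_one
  exact (abs_truncate_le _ V _).trans_eq (abs_of_nonneg ArithmeticFunction.vonMangoldt_nonneg)

theorem truncate_mul_truncate_of_lt (f g : ArithmeticFunction ℝ) {V n : ℕ} (h : V ^ 2 < n) :
    (truncate f V * truncate g V) n = 0 := by
  rw [ArithmeticFunction.mul_apply]
  refine Finset.sum_eq_zero fun x hx => ?_
  have hx := (Nat.mem_divisorsAntidiagonal.1 hx).1
  rcases le_or_gt x.1 V with h1 | h1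
  · rcases le_or_gt x.2 V with h2 | h2
    · nlinarith [Nat.mul_le_mul h1 h2]
    · rw [truncate_apply_of_lt g h2, mul_zero]
  · rw [truncate_apply_of_lt f h1, zero_mul]

/-! ### The exponential sum over primes -/

/-- A Vinogradov-type bound: if `θ, 2θ, …, Jθ` stay at distance `≥ 1 / (6 J)` from the integers, as
they do when `θ` has a reduced rational approximation with denominator about `2 J`, then the
exponential sum over primes at `θ` is smaller than the trivial bound by almost `√V`, where `V` is
the cut-off in Vaughan's identity. -/
theorem norm_sum_vonMangoldt_eChar_le {θ : ℝ} {J V N : ℕ} (hV : 1 ≤ V) (hVJ : V ^ 2 ≤ J)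
    (hJVN : V ^ 3 * J ≤ N) (hJN : 3 * J ≤ N)
    (hθ : ∀ j : ℕ, 1 ≤ j → j ≤ J → 1 / (6 * (J : ℝ)) ≤ distNearestInt (θ * j)) :
    ‖∑ n ∈ Finset.Ioc 0 N, (Λ n : ℂ) * eChar (θ * n)‖
      ≤ 21 * (1 + Real.log N) ^ 4 * N / √V := by
  have hV2 : V ≤ V ^ 2 := Nat.le_self_pow two_ne_zero V
  have hV3 : V ≤ V ^ 3 := Nat.le_self_pow three_ne_zero V
  have hJ : 1 ≤ J := hV.trans (hV2.trans hVJ)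
  have hV2N : V ^ 2 ≤ N := by omega
  have hN1 : 1 ≤ N := by omega
  have hJVN1 : J * V ≤ N := by
    rw [mul_comm]; exact (Nat.mul_le_mul_right J hV3).trans hJVN
  have hlog : ∀ n : ℕ, n ≤ N → Real.log n ≤ Real.log N := by
    intro n hn
    rcases Nat.eq_zero_or_pos n with rfl | h
    · simpa using Real.log_natCast_nonneg N
    · exact Real.log_le_log (by exact_mod_cast h) (by exact_mod_cast hn)
  set L := 1 + Real.log N with hL
  have hlogL : Real.log N ≤ L := by linarith
  have hL1 : 1 ≤ L := by have := Real.log_natCast_nonneg N; linarith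
  have hV0 : (1 : ℝ) ≤ V := by exact_mod_cast hV
  have hJ0 : (1 : ℝ) ≤ J := by exact_mod_cast hJ
  have hδ : (0 : ℝ) < 1 / (6 * (J : ℝ)) := by positivity
  have hlog_mono : Monotone (ArithmeticFunction.log : ArithmeticFunction ℝ) := by
    intro m n hmn
    simp only [ArithmeticFunction.log_apply]
    rcases Nat.eq_zero_or_pos m with rfl | h
    · simpa using Real.log_natCast_nonneg n
    · exact Real.log_le_log (by exact_mod_cast h) (by exact_mod_cast hmn)
  have hzeta_mono : Monotone realZeta := by
    intro m n hmn
    simp only [ArithmeticFunction.natCoe_apply, ArithmeticFunction.zeta_apply]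
    split_ifs <;> first | omega | simp
  set E : ArithmeticFunction ℝ → ℂ := fun f => ∑ n ∈ Finset.Ioc 0 N, (f n : ℂ) * eChar (θ * n)
    with hE
  have hsplit : E Λ = E (truncate Λ V) + E (truncate realMoebius V * ArithmeticFunction.log)
      - E (truncate realMoebius V * truncate Λ V * realZeta)
      + E ((realMoebius - truncate realMoebius V) * realZeta * (Λ - truncate Λ V)) := by
    simp only [hE]
    rw [← Finset.sum_add_distrib, ← Finset.sum_sub_distrib, ← Finset.sum_add_distrib]
    refine Finset.sum_congr rfl fun n _ => ?_
    conv_lhs => rw [vonMangoldt_eq_vaughan V]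
    simp only [ArithmeticFunction.add_apply, arithmeticFunction_sub_apply]
    push_cast
    ring
  have b1 : ‖E (truncate Λ V)‖ ≤ V * L := by
    have : ∀ n ∈ Finset.Ioc 0 N, ‖(truncate Λ V n : ℂ) * eChar (θ * n)‖
        ≤ if n ≤ V then L else 0 := by
      intro n hn
      rw [norm_mul, norm_eChar, mul_one, Complex.norm_real, Real.norm_eq_abs]
      split_ifs with h
      · exact (abs_truncate_le _ V n).trans ((abs_vonMangoldt_le_log n).trans
          ((hlog n (Finset.mem_Ioc.1 hn).2).trans hlogL))
      · rw [truncate_apply_of_lt _ (not_le.1 h), abs_zero]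
    refine (norm_sum_le_of_le _ this).trans ?_
    rw [← Finset.sum_filter, Finset.sum_const, nsmul_eq_mul]
    refine mul_le_mul_of_nonneg_right ?_ (by linarith)
    have : (Finset.Ioc 0 N).filter (· ≤ V) ⊆ Finset.Ioc 0 V := by
      intro d; simp only [Finset.mem_filter, Finset.mem_Ioc]; omega
    exact_mod_cast (Finset.card_le_card this).trans_eq (by simp)
  have b2 : ‖E (truncate realMoebius V * ArithmeticFunction.log)‖ ≤ V * (1 * (L * (6 * J))) := by
    refine (norm_type_one_sum_le hδ (hV2.trans hVJ) hθ zero_le_one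
      (fun d _ => (abs_truncate_le _ V d).trans (abs_realMoebius_le_one d))
      (fun d hd => truncate_apply_of_lt _ hd) hlog_mono N).trans ?_
    rw [div_div_eq_mul_div, div_one, ArithmeticFunction.log_apply]
    gcongr
  have b3 : ‖E (truncate realMoebius V * truncate Λ V * realZeta)‖
      ≤ (V ^ 2 : ℕ) * (L * (1 * (6 * J))) := by
    refine (norm_type_one_sum_le hδ hVJ hθ (A := L) (by linarith)
      (fun d hd => (abs_truncate_mul_truncate_le V d).trans
        ((hlog d (hd.trans hV2N)).trans hlogL))
      (fun d hd => truncate_mul_truncate_of_lt _ _ hd) hzeta_mono N).trans_eq ?_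
    rw [div_div_eq_mul_div, div_one, ArithmeticFunction.natCoe_apply,
      ArithmeticFunction.zeta_apply_ne (by omega), Nat.cast_one]
  have b4 : ‖E ((realMoebius - truncate realMoebius V) * realZeta * (Λ - truncate Λ V))‖
      ≤ 8 * L ^ 4 * N / √V := by
    refine (sq_le_sq₀ (norm_nonneg _) (by positivity)).1 ?_
    refine (norm_type_two_sum_le (A := L) hV (hV2.trans hVJ) hJN hJVN1 hθ
      (abs_sub_truncate_moebius_mul_zeta_le V) (fun v hv => sub_truncate_moebius_mul_zeta_of_le hv)
      (fun u hu => (abs_sub_truncate_le _ V u).trans ((abs_vonMangoldt_le_log u).trans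
        ((hlog u hu).trans hlogL)))
      (fun u hu => sub_truncate_apply_of_le _ hu)).trans ?_
    rw [← hL, div_pow, Real.sq_sqrt (by positivity)]
    gcongr
    have : 0 ≤ L ^ 8 * (N : ℝ) ^ 2 := by positivity
    nlinarith
  have hs1 : 1 ≤ √(V : ℝ) := Real.one_le_sqrt.2 hV0
  have hsV : √(V : ℝ) * √V = V := Real.mul_self_sqrt (by positivity)
  have hsV' : √(V : ℝ) ≤ V := by nlinarith
  have hL4 : L ≤ L ^ 4 := le_self_pow₀ hL1 (by norm_num)
  have hN3 : (V : ℝ) ^ 3 * J ≤ N := by exact_mod_cast hJVN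
  -- The linear terms are at most `V ^ 2 * J * L` up to a constant, and `V ^ 3 * J ≤ N`.
  have key : (V : ℝ) ^ 2 * J * L ≤ L ^ 4 * N / √V := by
    rw [le_div_iff₀ (by positivity)]
    calc (V : ℝ) ^ 2 * J * L * √V ≤ (V : ℝ) ^ 2 * J * L ^ 4 * V := by gcongr
      _ = L ^ 4 * ((V : ℝ) ^ 3 * J) := by ring
      _ ≤ L ^ 4 * N := by gcongr
  have hVV : (V : ℝ) ≤ V ^ 2 := by nlinarith
  have c1 : (V : ℝ) * L ≤ V ^ 2 * J * L := by
    have : (V : ℝ) ≤ V ^ 2 * J := by nlinarith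
    gcongr
  have c2 : (V : ℝ) * (1 * (L * (6 * J))) ≤ 6 * (V ^ 2 * J * L) := by
    calc (V : ℝ) * (1 * (L * (6 * J))) = 6 * (V * J * L) := by ring
      _ ≤ _ := by gcongr
  have c3 : ((V ^ 2 : ℕ) : ℝ) * (L * (1 * (6 * J))) = 6 * (V ^ 2 * J * L) := by
    push_cast; ring
  change ‖E Λ‖ ≤ _
  calc ‖E Λ‖ ≤ ‖E (truncate Λ V)‖ + ‖E (truncate realMoebius V * ArithmeticFunction.log)‖
      + ‖E (truncate realMoebius V * truncate Λ V * realZeta)‖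
      + ‖E ((realMoebius - truncate realMoebius V) * realZeta * (Λ - truncate Λ V))‖ := by
        rw [hsplit]
        refine (norm_add_le _ _).trans (add_le_add_left ?_ _)
        refine (norm_sub_le _ _).trans (add_le_add_left ?_ _)
        exact norm_add_le _ _
    _ ≤ 13 * (L ^ 4 * N / √V) + 8 * L ^ 4 * N / √V := by linarith
    _ = _ := by ring

/-! ### Diophantine type -/

theorem distNearestInt_pos_of_irrational {x : ℝ} (hx : Irrational x) : 0 < distNearestInt x := by
  rw [distNearestInt, abs_pos, sub_ne_zero]
  exact hx.ne_int _

/-- A number of type `< ϱ` is badly approximable with exponent `ϱ`. -/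
theorem exists_le_distNearestInt_of_type_lt {γ τ ϱ : ℝ} (hγ : Irrational γ)
    (hτ : diophantineType γ = (τ : EReal)) (hϱ : τ < ϱ) :
    ∃ c : ℝ, 0 < c ∧ ∀ n : ℕ, 1 ≤ n → c ≤ (n : ℝ) ^ ϱ * distNearestInt (γ * n) := by
  set f : ℕ → ℝ := fun n => (n : ℝ) ^ ϱ * distNearestInt (γ * n) with hf
  have hne : liminf (fun n : ℕ => (f n : EReal)) atTop ≠ 0 := by
    intro h
    have : (ϱ : EReal) ≤ diophantineType γ := le_sSup ⟨ϱ, h, rfl⟩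
    rw [hτ, EReal.coe_le_coe_iff] at this
    exact absurd this (not_le.2 hϱ)
  have hnonneg : (0 : EReal) ≤ liminf (fun n : ℕ => (f n : EReal)) atTop := by
    refine le_liminf_of_le (by isBoundedDefault) (Eventually.of_forall fun n => ?_)
    exact EReal.coe_nonneg.2 (mul_nonneg (by positivity) (distNearestInt_nonneg _))
  obtain ⟨b, hb0, hb⟩ := EReal.lt_iff_exists_real_btwn.1 (lt_of_le_of_ne hnonneg hne.symm)
  obtain ⟨n₀, hn₀⟩ := eventually_atTop.1 (eventually_lt_of_lt_liminf hb)
  have hpos : ∀ n : ℕ, 1 ≤ n → 0 < f n := fun n hn =>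
    mul_pos (Real.rpow_pos_of_pos (by exact_mod_cast hn) _)
      (distNearestInt_pos_of_irrational (hγ.mul_natCast (by omega)))
  have hfin : ∀ m : ℕ, ∃ c : ℝ, 0 < c ∧ ∀ n : ℕ, 1 ≤ n → n < m → c ≤ f n := by
    intro m
    induction m with
    | zero => exact ⟨1, one_pos, fun n _ h => absurd h (Nat.not_lt_zero n)⟩
    | succ m ih =>
      obtain ⟨c, hc, h⟩ := ih
      rcases Nat.eq_zero_or_pos m with rfl | hm
      · exact ⟨c, hc, fun n h1 h2 => by omega⟩
      · refine ⟨min c (f m), lt_min hc (hpos m hm), fun n h1 h2 => ?_⟩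
        rcases Nat.lt_succ_iff_lt_or_eq.1 h2 with h3 | rfl
        · exact (min_le_left _ _).trans (h n h1 h3)
        · exact min_le_right _ _
  obtain ⟨c, hc, h⟩ := hfin n₀
  refine ⟨min c b, lt_min hc (EReal.coe_pos.1 hb0), fun n hn => ?_⟩
  rcases lt_or_ge n n₀ with h1 | h1
  · exact (min_le_left _ _).trans (h n hn h1)
  · exact (min_le_right _ _).trans (EReal.coe_lt_coe_iff.1 (hn₀ n h1)).le

/-- By Dirichlet's approximation theorem the exponent of approximation is at least `1`. -/
theorem one_le_of_le_distNearestInt {γ ϱ c : ℝ} (hc : 0 < c) (hϱ : 0 < ϱ)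
    (h : ∀ n : ℕ, 1 ≤ n → c ≤ (n : ℝ) ^ ϱ * distNearestInt (γ * n)) : 1 ≤ ϱ := by
  by_contra! hlt
  have ht : Tendsto (fun n : ℕ => (n : ℝ) ^ (-(1 - ϱ))) atTop (nhds 0) :=
    (tendsto_rpow_neg_atTop (sub_pos.2 hlt)).comp tendsto_natCast_atTop_atTop
  obtain ⟨n, hn, hn1⟩ := ((ht.eventually_lt_const hc).and (eventually_ge_atTop 1)).exists
  obtain ⟨k, hk0, hkn, hk⟩ := Real.exists_nat_abs_mul_sub_round_le γ hn1
  have hn0 : (0 : ℝ) < n := by exact_mod_cast hn1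
  have h1 : distNearestInt (γ * k) ≤ 1 / n := by
    rw [mul_comm, distNearestInt]
    exact hk.trans (one_div_le_one_div_of_le hn0 (by linarith))
  have h2 : (k : ℝ) ^ ϱ ≤ (n : ℝ) ^ ϱ :=
    Real.rpow_le_rpow (by positivity) (by exact_mod_cast hkn) hϱ.le
  have h3 : (n : ℝ) ^ ϱ * (1 / n) = (n : ℝ) ^ (-(1 - ϱ)) := by
    rw [neg_sub, Real.rpow_sub hn0, Real.rpow_one, mul_one_div]
  have h4 := mul_le_mul h2 h1 (distNearestInt_nonneg _) (by positivity)
  linarith [h k hk0]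

/-! ### Residue classes -/

theorem sum_eChar_div_mul (z : ℤ) {q : ℕ} (hq : 0 < q) :
    ∑ b ∈ Finset.range q, eChar ((z : ℝ) / q * b) = if (q : ℤ) ∣ z then (q : ℂ) else 0 := by
  have hq0 : (q : ℝ) ≠ 0 := by exact_mod_cast hq.ne'
  simp only [eChar_mul_natCast]
  split_ifs with h
  · obtain ⟨t, rfl⟩ := h
    have : ((((q : ℤ) * t : ℤ) : ℝ)) / q = (t : ℝ) := by push_cast; field_simp
    rw [this, eChar_intCast]
    simp
  · have hne : eChar ((z : ℝ) / q) - 1 ≠ 0 := by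
      intro h0
      have h1 := four_mul_distNearestInt_le ((z : ℝ) / q)
      rw [h0, norm_zero] at h1
      have h2 : distNearestInt ((z : ℝ) / q) = 0 :=
        le_antisymm (by linarith) (distNearestInt_nonneg _)
      rw [distNearestInt, abs_eq_zero, sub_eq_zero, div_eq_iff hq0] at h2
      exact h ⟨round ((z : ℝ) / q), by rw [mul_comm]; exact_mod_cast h2⟩
    have h3 := mul_geom_sum (eChar ((z : ℝ) / q)) q
    rw [← eChar_mul_natCast, div_mul_cancel₀ _ hq0, eChar_intCast, sub_self] at h3
    exact (mul_eq_zero.1 h3).resolve_left hne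

/-- Detecting the residue class `a` modulo `q` by additive characters. -/
theorem norm_mangoldtExpSum_le (γ : ℝ) (k a : ℕ) {q : ℕ} (hq : 0 < q) (M : ℝ) {B : ℝ}
    (hB : ∀ b : ℕ, b < q →
      ‖∑ m ∈ Finset.Ioc 0 ⌊M⌋₊, (Λ m : ℂ) * eChar ((γ * k + (b : ℝ) / q) * m)‖ ≤ B) :
    ‖mangoldtExpSum γ k a q M‖ ≤ B := by
  have hq0 : (0 : ℝ) < q := by exact_mod_cast hq
  have h1 : (q : ℂ) * mangoldtExpSum γ k a q M
      = ∑ b ∈ Finset.range q, eChar (-((b : ℝ) * a / q)) *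
        ∑ m ∈ Finset.Ioc 0 ⌊M⌋₊, (Λ m : ℂ) * eChar ((γ * k + (b : ℝ) / q) * m) := by
    have h2 : ∀ m : ℕ, ∑ b ∈ Finset.range q,
        eChar (-((b : ℝ) * a / q)) * ((Λ m : ℂ) * eChar ((γ * k + (b : ℝ) / q) * m))
        = if m ≡ a [MOD q] then (q : ℂ) * ((Λ m : ℂ) * eChar (γ * k * m)) else 0 := by
      intro m
      have h3 : ∀ b : ℕ, eChar (-((b : ℝ) * a / q)) *
          ((Λ m : ℂ) * eChar ((γ * k + (b : ℝ) / q) * m))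
          = (Λ m : ℂ) * eChar (γ * k * m) * eChar ((((m : ℤ) - a : ℤ) : ℝ) / q * b) := by
        intro b
        rw [show (((m : ℤ) - a : ℤ) : ℝ) / q * b = -((b : ℝ) * a / q) + (b : ℝ) / q * m by
          push_cast; ring, add_mul, eChar_add, eChar_add]
        ring
      simp only [h3]
      rw [← Finset.mul_sum, sum_eChar_div_mul _ hq]
      have h4 : (q : ℤ) ∣ (m : ℤ) - a ↔ m ≡ a [MOD q] := by
        rw [← Nat.modEq_iff_dvd, Nat.ModEq.comm]
      simp only [h4]
      split_ifs <;> ring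
    simp only [Finset.mul_sum]
    rw [Finset.sum_comm]
    simp only [h2]
    rw [← Finset.sum_filter, mangoldtExpSum, Finset.mul_sum]
    rfl
  have h5 : (q : ℝ) * ‖mangoldtExpSum γ k a q M‖ ≤ q * B := by
    rw [← Complex.norm_natCast, ← norm_mul, h1]
    refine (norm_sum_le_of_le (f := _) _ fun b hb => ?_).trans_eq
      (show ∑ b ∈ Finset.range q, B = _ by simp)
    rw [norm_mul, norm_eChar, one_mul]
    exact hB b (Finset.mem_range.1 hb)
  exact le_of_mul_le_mul_left h5 hq0

/-! ### Rational approximation -/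

/-- If `p` is a reduced fraction with denominator `s ≥ 2` and `|θ - p| ≤ 1 / s ^ 2`, then for
`1 ≤ j ≤ s / 2` the number `p j` is not an integer, so it is `1 / s`-far from the integers, and
`θ j` is within `1 / (2 s)` of it. -/
theorem le_distNearestInt_of_approx {θ : ℝ} {p : ℚ} {n : ℕ}
    (hp : |θ - p| ≤ 1 / ((n + 1) * p.den)) (hn : p.den ≤ n) {j : ℕ} (hj1 : 1 ≤ j)
    (hj : j ≤ p.den / 2) :
    1 / (6 * ((p.den / 2 : ℕ) : ℝ)) ≤ distNearestInt (θ * j) := by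
  set s := p.den with hs
  set r := round (θ * j) with hr
  have hs2 : 2 ≤ s := by omega
  have hs0 : (0 : ℝ) < s := by exact_mod_cast p.den_pos
  have hpr : (p : ℝ) = p.num / s := by exact_mod_cast (Rat.num_div_den p).symm
  have hint : p.num * j - r * s ≠ 0 := by
    intro h0
    have hdvd : (s : ℤ) ∣ p.num * j := ⟨r, by linarith⟩
    have hdvd' : s ∣ p.num.natAbs * j := by
      have := Int.natAbs_dvd_natAbs.2 hdvd
      rwa [Int.natAbs_mul, Int.natAbs_natCast, Int.natAbs_natCast] at this
    have := Nat.le_of_dvd hj1 (p.reduced.symm.dvd_of_dvd_mul_left hdvd')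
    omega
  have h1 : 1 / (s : ℝ) ≤ |(p : ℝ) * j - r| := by
    have h2 : (1 : ℝ) ≤ |((p.num * j - r * s : ℤ) : ℝ)| := by
      exact_mod_cast Int.one_le_abs hint
    have h3 : (p : ℝ) * j - r = ((p.num * j - r * s : ℤ) : ℝ) / s := by
      rw [hpr]; push_cast; field_simp
    rw [h3, abs_div, abs_of_pos hs0]
    gcongr
  have hjs : (j : ℝ) ≤ s / 2 := by
    have : j * 2 ≤ s := by omega
    have : (j : ℝ) * 2 ≤ s := by exact_mod_cast this
    linarith
  have h4 : |(θ - p) * j| ≤ 1 / (2 * s) := by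
    have hns : (s : ℝ) ≤ n + 1 := by
      have : (s : ℝ) ≤ n := by exact_mod_cast hn
      linarith
    rw [abs_mul, Nat.abs_cast]
    calc |θ - p| * j ≤ 1 / ((s : ℝ) * s) * (s / 2) := by
          refine mul_le_mul (hp.trans ?_) hjs (by positivity) (by positivity)
          gcongr
      _ = 1 / (2 * s) := by field_simp
  have h5 : |(p : ℝ) * j - r| ≤ |θ * j - r| + |(θ - p) * j| := by
    have : (p : ℝ) * j - r = (θ * j - r) - (θ - p) * j := by ring
    rw [this]; exact abs_sub _ _
  have h6 : 1 / (6 * ((s / 2 : ℕ) : ℝ)) ≤ 1 / (2 * s) := by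
    have : s ≤ 3 * (s / 2) := by omega
    have : (s : ℝ) ≤ 3 * ((s / 2 : ℕ) : ℝ) := by exact_mod_cast this
    exact one_div_le_one_div_of_le (by positivity) (by linarith)
  have h7 : 1 / (s : ℝ) = 1 / (2 * s) + 1 / (2 * s) := by field_simp; norm_num
  rw [distNearestInt]
  linarith

/-- The denominator of a good rational approximation to `γ k + b / q` cannot be small, since
clearing denominators gives a good approximation to the multiple `q s k` of `γ`. -/
theorem le_den_rpow_of_approx {γ ϱ c : ℝ}
    (hγ : ∀ n : ℕ, 1 ≤ n → c ≤ (n : ℝ) ^ ϱ * distNearestInt (γ * n)) {k b q n : ℕ}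
    (hk : 1 ≤ k) (hq : 1 ≤ q) {p : ℚ}
    (hp : |γ * k + (b : ℝ) / q - p| ≤ 1 / ((n + 1) * p.den)) :
    c * (n + 1) ≤ q * ((q : ℝ) * k) ^ ϱ * (p.den : ℝ) ^ ϱ := by
  set s := p.den with hs
  have hs0 : (0 : ℝ) < s := by exact_mod_cast p.den_pos
  have hq0 : (0 : ℝ) < q := by exact_mod_cast hq
  have hn0 : (0 : ℝ) < (n : ℝ) + 1 := by positivity
  have hpr : (p : ℝ) = p.num / s := by exact_mod_cast (Rat.num_div_den p).symm
  have h1 : distNearestInt (γ * ((q * k * s : ℕ) : ℝ)) ≤ q / (n + 1) := by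
    refine (distNearestInt_le_abs_sub _ (q * p.num - b * s)).trans ?_
    have : γ * ((q * k * s : ℕ) : ℝ) - ((q * p.num - b * s : ℤ) : ℝ)
        = q * s * (γ * k + (b : ℝ) / q - p) := by
      rw [hpr]; push_cast; field_simp; ring
    rw [this, abs_mul, abs_of_pos (by positivity)]
    calc q * s * |γ * k + (b : ℝ) / q - p| ≤ q * s * (1 / ((n + 1) * s)) := by gcongr
      _ = q / (n + 1) := by field_simp
  have h2 := hγ (q * k * s) (Nat.mul_pos (Nat.mul_pos hq hk) p.den_pos)
  have h3 : c ≤ ((q * k * s : ℕ) : ℝ) ^ ϱ * (q / (n + 1)) :=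
    h2.trans (mul_le_mul_of_nonneg_left h1 (by positivity))
  rw [mul_div_assoc', le_div_iff₀ hn0] at h3
  refine h3.trans_eq ?_
  push_cast
  rw [Real.mul_rpow (by positivity) (by positivity)]
  ring

/-! ### Choice of parameters -/

/-- The choice of parameters: with `κ = 1 / (8 ϱ)`, Dirichlet's theorem provides a denominator
`s ≤ M ^ (1 - 3 κ)`, which is at least `3 M ^ (2 κ)` by `le_den_rpow_of_approx`; the cut-off
`V = ⌊M ^ κ⌋` and `J = ⌊s / 2⌋` are then admissible in `norm_sum_vonMangoldt_eChar_le`. -/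
theorem norm_sum_vonMangoldt_twist_le {γ ϱ c ε M : ℝ} (hc : 0 < c) (hϱ : 1 ≤ ϱ)
    (hε : 0 < ε) (hεϱ : ε * ϱ ≤ 1 / 8)
    (hγ : ∀ n : ℕ, 1 ≤ n → c ≤ (n : ℝ) ^ ϱ * distNearestInt (γ * n)) (hM : 1 ≤ M)
    (hM1 : 2 ≤ M ^ (1 / (8 * ϱ)))
    (hM2 : (3 : ℝ) ^ ϱ * M ^ (1 / 4 : ℝ) ≤ c * M ^ (7 / 16 : ℝ))
    (hM3 : 42 * (1 + Real.log M) ^ 4 ≤ M ^ (1 / (8 * ϱ) / 4))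
    {k q b : ℕ} (hk : 1 ≤ k) (hkM : (k : ℝ) ≤ M ^ ε) (hq : 1 ≤ q) (hqM : (q : ℝ) ≤ M ^ (ε / 4)) :
    ‖∑ m ∈ Finset.Ioc 0 ⌊M⌋₊, (Λ m : ℂ) * eChar ((γ * k + (b : ℝ) / q) * m)‖
      ≤ M ^ (1 - 1 / (8 * ϱ) / 4) := by
  have hM0 : 0 < M := by linarith
  have hϱ0 : 0 < ϱ := by linarith
  set κ := 1 / (8 * ϱ) with hκ
  have hκ0 : 0 < κ := by positivity
  have hκϱ : κ * ϱ = 1 / 8 := by rw [hκ]; field_simp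
  have hκ8 : κ ≤ 1 / 8 := by nlinarith
  have hε8 : ε ≤ 1 / 8 := by nlinarith
  set n := ⌊M ^ (1 - 3 * κ)⌋₊ with hn
  have hn_le : (n : ℝ) ≤ M ^ (1 - 3 * κ) := Nat.floor_le (by positivity)
  have hn_lt : M ^ (1 - 3 * κ) < n + 1 := Nat.lt_floor_add_one _
  have hn_pos : 0 < n := Nat.floor_pos.2 (Real.one_le_rpow hM (by linarith))
  set θ := γ * k + (b : ℝ) / q with hθ
  obtain ⟨p, hp, hpn⟩ := Real.exists_rat_abs_sub_le_and_den_le θ hn_pos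
  set s := p.den with hs
  have hs0 : (0 : ℝ) < s := by exact_mod_cast p.den_pos
  -- The denominator is large.
  have h1 := le_den_rpow_of_approx hγ hk hq hp
  have h2 : (q : ℝ) * ((q : ℝ) * k) ^ ϱ ≤ M ^ (3 / 16 : ℝ) := by
    calc (q : ℝ) * ((q : ℝ) * k) ^ ϱ ≤ M ^ (ε / 4) * (M ^ (ε / 4) * M ^ ε) ^ ϱ := by gcongr
      _ = M ^ (ε / 4 + (ε / 4 + ε) * ϱ) := by
          rw [← Real.rpow_add hM0, ← Real.rpow_mul hM0.le, ← Real.rpow_add hM0]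
      _ ≤ _ := Real.rpow_le_rpow_of_exponent_le hM (by linarith)
  have h3 : c * M ^ (7 / 16 : ℝ) ≤ (s : ℝ) ^ ϱ := by
    have h4 : c * M ^ (1 - 3 * κ) ≤ M ^ (3 / 16 : ℝ) * (s : ℝ) ^ ϱ :=
      (mul_le_mul_of_nonneg_left hn_lt.le hc.le).trans
        (h1.trans (mul_le_mul_of_nonneg_right h2 (by positivity)))
    have h5 : M ^ (3 / 16 : ℝ) * M ^ (7 / 16 : ℝ) ≤ M ^ (1 - 3 * κ) := by
      rw [← Real.rpow_add hM0]
      exact Real.rpow_le_rpow_of_exponent_le hM (by linarith)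
    have h6 : 0 < M ^ (3 / 16 : ℝ) := Real.rpow_pos_of_pos hM0 _
    refine le_of_mul_le_mul_left ?_ h6
    calc M ^ (3 / 16 : ℝ) * (c * M ^ (7 / 16 : ℝ))
        = c * (M ^ (3 / 16 : ℝ) * M ^ (7 / 16 : ℝ)) := by ring
      _ ≤ c * M ^ (1 - 3 * κ) := by gcongr
      _ ≤ _ := h4
  have hsM : 3 * M ^ (2 * κ) ≤ s := by
    refine (Real.rpow_le_rpow_iff (by positivity) hs0.le hϱ0).1 (le_trans (le_of_eq ?_)
      (hM2.trans h3))
    rw [Real.mul_rpow (by norm_num) (by positivity), ← Real.rpow_mul hM0.le]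
    congr 2
    linarith
  have hs3 : 3 ≤ s := by
    have : (1 : ℝ) ≤ M ^ (2 * κ) := Real.one_le_rpow hM (by positivity)
    have : (3 : ℝ) ≤ s := by linarith
    exact_mod_cast this
  set J := s / 2 with hJ
  have hsJ : (s : ℝ) ≤ 3 * J := by exact_mod_cast (by omega : s ≤ 3 * (s / 2))
  have hJs : (J : ℝ) ≤ s := by exact_mod_cast Nat.div_le_self s 2
  set V := ⌊M ^ κ⌋₊ with hV
  have hV_le : (V : ℝ) ≤ M ^ κ := Nat.floor_le (by positivity)
  have hV_lt : M ^ κ < V + 1 := Nat.lt_floor_add_one _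
  have hV2 : 2 ≤ V := Nat.le_floor (by exact_mod_cast hM1)
  have hVJ : V ^ 2 ≤ J := by
    have : (V : ℝ) ^ 2 ≤ M ^ (2 * κ) := by
      rw [mul_comm, Real.rpow_mul hM0.le]
      exact_mod_cast pow_le_pow_left₀ (by positivity) hV_le 2
    have : (V : ℝ) ^ 2 ≤ J := by linarith
    exact_mod_cast this
  have hVJN : V ^ 3 * J ≤ ⌊M⌋₊ := by
    refine Nat.le_floor ?_
    have h6 : (V : ℝ) ^ 3 ≤ M ^ (3 * κ) := by
      rw [mul_comm, Real.rpow_mul hM0.le]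
      exact_mod_cast pow_le_pow_left₀ (by positivity) hV_le 3
    have h7 : (J : ℝ) ≤ M ^ (1 - 3 * κ) :=
      hJs.trans (le_trans (by exact_mod_cast hpn) hn_le)
    push_cast
    calc (V : ℝ) ^ 3 * J ≤ M ^ (3 * κ) * M ^ (1 - 3 * κ) := by gcongr
      _ = M := by rw [← Real.rpow_add hM0]; simp
  have h3J : 3 * J ≤ ⌊M⌋₊ := by
    refine le_trans (Nat.mul_le_mul_right J ?_) hVJN
    calc 3 ≤ 2 ^ 3 := by norm_num
      _ ≤ V ^ 3 := Nat.pow_le_pow_left hV2 3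
  refine (norm_sum_vonMangoldt_eChar_le (by omega) hVJ hVJN h3J
    fun j hj1 hj => le_distNearestInt_of_approx hp hpn hj1 hj).trans ?_
  have hN : ((⌊M⌋₊ : ℕ) : ℝ) ≤ M := Nat.floor_le hM0.le
  have hN1 : (1 : ℝ) ≤ ((⌊M⌋₊ : ℕ) : ℝ) := by exact_mod_cast Nat.floor_pos.2 hM
  have hlog : Real.log (⌊M⌋₊ : ℕ) ≤ Real.log M := Real.log_le_log (by linarith) hN
  have hlog0 : 0 ≤ Real.log (⌊M⌋₊ : ℕ) := Real.log_nonneg hN1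
  have hsqrt : M ^ (κ / 2) / 2 ≤ √V := by
    refine Real.le_sqrt_of_sq_le ?_
    have h6 : (M ^ (κ / 2)) ^ 2 = M ^ κ := by
      rw [← Real.rpow_natCast, ← Real.rpow_mul hM0.le]
      congr 1
      push_cast
      ring
    have h7 : (2 : ℝ) ≤ V := by exact_mod_cast hV2
    rw [div_pow, h6]
    linarith
  have hpos : 0 < M ^ (κ / 2) := Real.rpow_pos_of_pos hM0 _
  calc 21 * (1 + Real.log (⌊M⌋₊ : ℕ)) ^ 4 * (⌊M⌋₊ : ℕ) / √V
      ≤ 21 * (1 + Real.log M) ^ 4 * M / (M ^ (κ / 2) / 2) := by gcongr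
    _ = 42 * (1 + Real.log M) ^ 4 * M / M ^ (κ / 2) := by rw [div_div_eq_mul_div]; ring
    _ ≤ M ^ (κ / 4) * M / M ^ (κ / 2) := by gcongr
    _ = M ^ (1 - κ / 4) := by
        rw [div_eq_iff hpos.ne', ← Real.rpow_add_one hM0.ne', ← Real.rpow_add hM0]
        congr 1
        ring

theorem eventually_mul_one_add_log_pow_le {r : ℝ} (hr : 0 < r) :
    ∀ᶠ M : ℝ in atTop, 42 * (1 + Real.log M) ^ 4 ≤ M ^ r := by
  have h0 : 0 < r / 8 := by positivity
  have h1 := (isLittleO_log_rpow_atTop h0).bound (show (0 : ℝ) < 1 / 2 by norm_num)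
  have h2 := (tendsto_rpow_atTop h0).eventually_ge_atTop 42
  filter_upwards [h1, h2, eventually_ge_atTop 1] with M h1 h2 hM
  have hM0 : 0 < M := by linarith
  have hlog : 0 ≤ Real.log M := Real.log_nonneg hM
  rw [Real.norm_of_nonneg hlog, Real.norm_of_nonneg (by positivity)] at h1
  set y := M ^ (r / 8) with hy
  have hyr : M ^ r = y ^ 8 := by
    rw [hy, ← Real.rpow_natCast, ← Real.rpow_mul hM0.le]
    congr 1
    push_cast
    ring
  have h3 : 1 + Real.log M ≤ y := by linarith
  have hy1 : 1 ≤ y := by linarith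
  rw [hyr]
  calc 42 * (1 + Real.log M) ^ 4 ≤ y * y ^ 4 := by gcongr
    _ = y ^ 5 := by ring
    _ ≤ y ^ 8 := pow_le_pow_right₀ hy1 (by norm_num)

theorem eventually_mul_rpow_le_mul_rpow {a b A B : ℝ} (hab : a < b) (hB : 0 < B) :
    ∀ᶠ M : ℝ in atTop, A * M ^ a ≤ B * M ^ b := by
  filter_upwards [(tendsto_rpow_atTop (sub_pos.2 hab)).eventually_ge_atTop (A / B),
    eventually_gt_atTop 0] with M h1 hM
  rw [div_le_iff₀ hB] at h1
  have h2 : M ^ b = M ^ (b - a) * M ^ a := by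
    rw [← Real.rpow_add hM, sub_add_cancel]
  have h3 : 0 ≤ M ^ a := Real.rpow_nonneg hM.le _
  rw [h2]
  nlinarith

theorem mainTheorem4 (γ : ℝ) (hγ : Irrational γ) (τ : ℝ) (hτ : diophantineType γ = (τ : EReal))
    (ε : ℝ) (hε : 0 < ε) (hετ : ε < 1 / (8 * τ)) :
    ∃ η : ℝ, 0 < η ∧ ∃ M₀ : ℝ, ∀ M : ℝ, M₀ ≤ M →
      ∀ k a q : ℕ, 1 ≤ k → (k : ℝ) ≤ M ^ ε → a < q → (q : ℝ) ≤ M ^ (ε / 4) → Nat.gcd a q = 1 →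
        ‖mangoldtExpSum γ k a q M‖ ≤ M ^ (1 - η) := by
  have hτ0 : 0 < τ := by
    by_contra! h
    have : 1 / (8 * τ) ≤ 0 := one_div_nonpos.2 (by linarith)
    linarith
  have hτε : τ < 1 / (8 * ε) := by
    rw [lt_div_iff₀ (by positivity)] at hετ ⊢
    linarith
  -- The hypothesis on `ε` says exactly that the exponent `1 / (8 ε)` exceeds the type.
  set ϱ := 1 / (8 * ε) with hϱ
  have hεϱ : ε * ϱ ≤ 1 / 8 := by
    rw [hϱ]; exact le_of_eq (by field_simp)
  have hϱ0 : 0 < ϱ := hτ0.trans hτε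
  obtain ⟨c, hc, hcγ⟩ := exists_le_distNearestInt_of_type_lt hγ hτ hτε
  have hϱ1 : 1 ≤ ϱ := one_le_of_le_distNearestInt hc hϱ0 hcγ
  have hκ : 0 < 1 / (8 * ϱ) := by positivity
  refine ⟨1 / (8 * ϱ) / 4, by positivity, ?_⟩
  have hev : ∀ᶠ M : ℝ in atTop, 1 ≤ M ∧ 2 ≤ M ^ (1 / (8 * ϱ))
      ∧ (3 : ℝ) ^ ϱ * M ^ (1 / 4 : ℝ) ≤ c * M ^ (7 / 16 : ℝ)
      ∧ 42 * (1 + Real.log M) ^ 4 ≤ M ^ (1 / (8 * ϱ) / 4) := by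
    filter_upwards [eventually_ge_atTop 1, (tendsto_rpow_atTop hκ).eventually_ge_atTop 2,
      eventually_mul_rpow_le_mul_rpow (A := (3 : ℝ) ^ ϱ)
        (show (1 / 4 : ℝ) < 7 / 16 by norm_num) hc,
      eventually_mul_one_add_log_pow_le (r := 1 / (8 * ϱ) / 4) (by positivity)]
      with M h1 h2 h3 h4
    exact ⟨h1, h2, h3, h4⟩
  obtain ⟨M₀, hM₀⟩ := eventually_atTop.1 hev
  refine ⟨M₀, fun M hM k a q hk hkM haq hqM _ => ?_⟩
  obtain ⟨h1, h2, h3, h4⟩ := hM₀ M hM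
  have hq : 1 ≤ q := by omega
  exact norm_mangoldtExpSum_le γ k a hq M fun b _ =>
    norm_sum_vonMangoldt_twist_le hc hϱ1 hε hεϱ hcγ h1 h2 h3 h4 hk hkM hq hqM
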